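/- Let $A=\{1,\dots,m\}$ and $B=\{1,\dots,n\}$ be the nonempty finite action sets of Alice and Bob, let $\beta\in[0,1)$, and let $\mathbf r(a,b)\in[0,1-\beta]^K$ be Alice's vector loss when $a\in A$ and $b\in B$ are played. Write $\mathbf u\preceq\mathbf v$ if $u_k\le v_k$ for all $k$, and for $\mathcal S\subseteq\mathbb R^K$ let $\Lambda(\mathcal S)=\{\mathbf x\in\mathcal S:\ \forall\,\mathbf x'\in\mathcal S\setminus\{\mathbf x\}\ \exists\,k,\ x_k<x'_k\}$ be its lower Pareto frontier. Let $\mathcal F$ be the space of nonempty sets $\mathcal V\subseteq[0,1]^K$ no element of which is $\preceq$ another one and whose upset $\{\mathbf x\in[0,1]^K:\ \mathbf y\preceq\mathbf x\text{ for some }\mathbf y\in\mathcal V\}$ is closed and convex. For $\mathcal V\in\mathcal F$ let $\Phi(\mathcal V)=\Lambda(\Psi(\mathcal V))$, where $$\Psi(\mathcal V)=\Big\{\Big(\max_{b\in B}\sum_{a\in A}\alpha_a\big[r_k(a,b)+\beta R_k(a,b)\big]\Big)_{k=1}^K:\ \boldsymbol\alpha\in\Delta(A),\ \mathbf R(a,b)\in\mathcal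 V\ \ \forall a\in A,\,b\in B\Big\}.$$ In the infinitely repeated game, both players simultaneously choose actions $a_t,b_t$ at the stages $t=1,2,\dots$. Let $\Pi_A$ and $\Pi_B$ be the sets of adaptive randomized strategies of Alice and Bob, which map each history $(a_1,b_1,\dots,a_{t-1},b_{t-1})$ to a probability distribution on $A$, respectively on $B$. Put $R^\infty_k(\pi_A,\pi_B)=\mathrm E_{\pi_A,\pi_B}\big[\sum_{t\ge1}\beta^{t-1}r_k(a_t,b_t)\big]$ and $$\mathcal W^\infty=\Big\{\Big(\max_{\pi_B^k\in\Pi_B}R^\infty_k(\pi_A,\pi_B^k)\Big)_{k=1}^K:\ \pi_A\in\Pi_A\Big\},\qquad \mathcal V^\infty=\Lambda(\mathcal W^\infty).$$ Then the unique fixed point $\mathcal V^*\in\mathcal F$ of $\Phi$ is $\mathcal V^\infty$. That is, $\mathcal V^\infty\in\mathcal F$, $\Phi(\mathcal V^\infty)=\mathcal V^\infty$, and every $\mathcal V\in\mathcal F$ with $\Phi(\mathcal V)=\mathcal V$ equals $\mathcal V^\infty$. -/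

import Mathlib

namespace VectorGame

open MeasureTheory ProbabilityTheory

/-! ## Pareto frontiers in `[0,1]^K`

Vectors are functions `Fin K → ℝ`, with the componentwise order. -/

/-- The lower Pareto frontier `Λ(S)`: the points `x` of `S` such that every other point of `S`
is strictly larger than `x` in some component. -/
def paretoFrontier {K : ℕ} (S : Set (Fin K → ℝ)) : Set (Fin K → ℝ) :=
  {x | x ∈ S ∧ ∀ x' ∈ S \ {x}, ∃ k, x k < x' k}

/-- The upset in `[0,1]^K`. -/
def upset {K : ℕ} (V : Set (Fin K → ℝ)) : Set (Fin K → ℝ) :=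
  {x | x ∈ Set.Icc 0 1 ∧ ∃ y ∈ V, y ≤ x}

/-- The space `𝓕` of (nonempty) Pareto frontiers in `[0,1]^K` with closed and convex upset. -/
def frontierSpace (K : ℕ) : Set (Set (Fin K → ℝ)) :=
  {V | V.Nonempty ∧ V ⊆ Set.Icc 0 1 ∧ (∀ u ∈ V, ∀ v ∈ V, u ≤ v → u = v) ∧
    IsClosed (upset V) ∧ Convex ℝ (upset V)}

/-! ## The dynamic programming operator

`A = Fin m` and `B = Fin n` are the action sets of Alice and Bob, `r a b k` is the `k`-th
component of the loss at `(a, b)`, and `β` is the discount factor. -/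

/-- The operator `Ψ`: simultaneous upper bounds obtained from a mixed action `α` and
continuation vectors `R a b ∈ S`; `u k` is the maximum over `b`. -/
def preOperator {m n K : ℕ} (β : ℝ) (r : Fin m → Fin n → Fin K → ℝ) (S : Set (Fin K → ℝ)) :
    Set (Fin K → ℝ) :=
  {u | ∃ α ∈ stdSimplex ℝ (Fin m), ∃ R : Fin m → Fin n → Fin K → ℝ,
    (∀ a b, R a b ∈ S) ∧
    ∀ k, IsGreatest (Set.range fun b : Fin n => ∑ a, α a * (r a b k + β * R a b k)) (u k)}

/-- The dynamic programming operator `Φ = Λ ∘ Ψ`. -/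
def dpOperator {m n K : ℕ} (β : ℝ) (r : Fin m → Fin n → Fin K → ℝ) (V : Set (Fin K → ℝ)) :
    Set (Fin K → ℝ) :=
  paretoFrontier (preOperator β r V)

/-! ## The infinitely repeated game

Stages are numbered `0, 1, 2, …`. -/

/-- The history before stage `t`: the pairs of actions played at the stages `0, …, t - 1`. -/
abbrev History (m n t : ℕ) : Type := Fin t → Fin m × Fin n

/-- Adaptive randomized strategies of Alice. -/
abbrev AliceStrategy (m n : ℕ) : Type := (t : ℕ) → History m n t → stdSimplex ℝ (Fin m)

/-- Adaptive randomized strategies of Bob. -/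
abbrev BobStrategy (m n : ℕ) : Type := (t : ℕ) → History m n t → stdSimplex ℝ (Fin n)

/-- The probability measure on `Fin N` with weights `p`. -/
noncomputable def simplexMeasure {N : ℕ} (p : stdSimplex ℝ (Fin N)) : Measure (Fin N) :=
  ∑ i, ENNReal.ofReal (p i) • Measure.dirac i

instance simplexMeasure_isProbabilityMeasure {N : ℕ} (p : stdSimplex ℝ (Fin N)) :
    IsProbabilityMeasure (simplexMeasure p) := by
  constructor
  have h : ∑ i, ENNReal.ofReal (p i) = 1 := by
    have h1 : ∑ i, p i = 1 := p.2.2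
    rw [← ENNReal.ofReal_sum_of_nonneg (fun i _ => show 0 ≤ p i from p.2.1 i), h1,
      ENNReal.ofReal_one]
  simpa [simplexMeasure] using h

/-- The law of the pair of actions played at stage `t` given the history: Alice and Bob
randomize independently. -/
noncomputable def stageLaw {m n : ℕ} (πA : AliceStrategy m n) (πB : BobStrategy m n) (t : ℕ)
    (h : History m n t) : Measure (Fin m × Fin n) :=
  (simplexMeasure (πA t h)).prod (simplexMeasure (πB t h))

instance stageLaw_isProbabilityMeasure {m n : ℕ} (πA : AliceStrategy m n)
    (πB : BobStrategy m n) (t : ℕ) (h : History m n t) :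
    IsProbabilityMeasure (stageLaw πA πB t h) := by
  unfold stageLaw; infer_instance

/-- The transition kernel from the play at the stages `0, …, t` to the pair of actions at
stage `t + 1`. -/
noncomputable def stageKernel {m n : ℕ} (πA : AliceStrategy m n) (πB : BobStrategy m n) (t : ℕ) :
    Kernel (Finset.Iic t → Fin m × Fin n) (Fin m × Fin n) where
  toFun x := stageLaw πA πB (t + 1)
    fun i => x ⟨i, Finset.mem_Iic.mpr (Nat.lt_succ_iff.mp i.isLt)⟩
  measurable' := Measurable.of_discrete

instance stageKernel_isMarkovKernel {m n : ℕ} (πA : AliceStrategy m n) (πB : BobStrategy m n)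
    (t : ℕ) : IsMarkovKernel (stageKernel πA πB t) :=
  ⟨fun _ => stageLaw_isProbabilityMeasure πA πB (t + 1) _⟩

/-- The law of the infinite play under a pair of strategies (Ionescu-Tulcea). -/
noncomputable def playMeasure {m n : ℕ} (πA : AliceStrategy m n) (πB : BobStrategy m n) :
    Measure (ℕ → Fin m × Fin n) :=
  Kernel.trajMeasure (X := fun _ => Fin m × Fin n) (stageLaw πA πB 0 Fin.elim0)
    (stageKernel πA πB)

/-- The expected total discounted loss on component `k` in the infinitely repeated game. -/
noncomputable def expectedLoss {m n K : ℕ} (β : ℝ) (r : Fin m → Fin n → Fin K → ℝ)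
    (πA : AliceStrategy m n) (πB : BobStrategy m n) (k : Fin K) : ℝ :=
  ∫ ω, ∑' t : ℕ, β ^ t * r (ω t).1 (ω t).2 k ∂(playMeasure πA πB)

/-- The set `𝓦^∞` of simultaneous worst-case upper bounds: `w` belongs to it if for some strategy
of Alice each `w k` is the maximum, over Bob's strategies, of the expected loss on component `k`
(the maximizing strategy of Bob may depend on `k`). -/
def guarantees {m n K : ℕ} (β : ℝ) (r : Fin m → Fin n → Fin K → ℝ) : Set (Fin K → ℝ) :=
  {w | ∃ πA : AliceStrategy m n, ∀ k,
    IsGreatest (Set.range fun πB : BobStrategy m n => expectedLoss β r πA πB k) (w k)}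

/-- The set `𝓥^∞ = Λ(𝓦^∞)`. -/
def optimalFrontier {m n K : ℕ} (β : ℝ) (r : Fin m → Fin n → Fin K → ℝ) : Set (Fin K → ℝ) :=
  paretoFrontier (guarantees β r)

end VectorGame

/-!
A closed frontier is determined by its upset, so `Φ` may be studied through the monotone operator
`U ↦ upset (Ψ U)`. Let `W` be the set of vectors that Alice can secure in the repeated game.
Conditioning on the first stage gives `W ⊆ upset (Ψ W)`. Conversely, if `U ⊆ upset (Ψ U)`, then
Alice secures every vector of `U` by carrying the vector still to be secured as a state, which she
updates after each stage. Hence `W` is the greatest `U` with `U ⊆ upset (Ψ U)` and is a fixed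
point; as the closure and the convex hull of `W` satisfy the same inclusion, `W` is closed and
convex. Uniqueness is a contraction argument: if translating a set by `c` (with truncation at `1`)
carries it into another one, then translating by `β * c` does so for their images under the
operator, and translating by `1` carries every vector of `[0,1]^K` to the vector `1`.
-/

namespace VectorGame

open MeasureTheory ProbabilityTheory Filter Topology

section Frontier

lemma exists_minimal_le_of_isCompact {α : Type*} [TopologicalSpace α] [Preorder α]
    [ClosedIicTopology α] {S : Set α} (hS : IsCompact S) {x : α} (hx : x ∈ S) :
    ∃ y ≤ x, Minimal (· ∈ S) y := by
  refine zorn_le_nonempty₀ (α := αᵒᵈ) S (fun c hcS hc z hz => ?_) x hx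
  obtain ⟨y, hyS, hy⟩ := hS.inter_iInter_nonempty (fun w : c => Set.Iic (OrderDual.ofDual w.1))
    (fun _ => isClosed_Iic) fun s => by
      have : Nonempty c := ⟨z, hz⟩
      obtain ⟨w, hw⟩ := hc.directedOn.directed_val.finset_le s
      exact ⟨w.1, hcS w.2, Set.mem_iInter₂.mpr hw⟩
  exact ⟨y, hyS, fun w hw => Set.mem_iInter.mp hy ⟨w, hw⟩⟩

variable {K : ℕ} {S : Set (Fin K → ℝ)}

lemma mem_paretoFrontier_iff_minimal {x : Fin K → ℝ} :
    x ∈ paretoFrontier S ↔ Minimal (· ∈ S) x := by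
  refine and_congr_right fun _ => forall_congr' fun y => ?_
  rw [Set.mem_sdiff, Set.mem_singleton_iff, and_imp]
  refine forall_congr' fun _ => ⟨fun h hyx => ?_, fun h hne => ?_⟩
  · by_contra hxy
    obtain ⟨k, hk⟩ := h fun heq => hxy heq.ge
    exact (hyx k).not_gt hk
  · by_contra! hyx
    exact hne (le_antisymm hyx (h hyx))

lemma paretoFrontier_subset : paretoFrontier S ⊆ S := fun _ hx => hx.1

lemma isAntichain_paretoFrontier : IsAntichain (· ≤ ·) (paretoFrontier S) := by
  have h : paretoFrontier S = {x | Minimal (· ∈ S) x} := by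
    ext x
    exact mem_paretoFrontier_iff_minimal
  exact h ▸ setOfPred_minimal_antichain _

lemma upset_subset_Icc : upset S ⊆ Set.Icc 0 1 := fun _ hx => hx.1

lemma subset_upset (hS : S ⊆ Set.Icc 0 1) : S ⊆ upset S := fun x hx => ⟨hS hx, x, hx, le_rfl⟩

lemma upset_mono {T : Set (Fin K → ℝ)} (h : S ⊆ T) : upset S ⊆ upset T :=
  fun _ ⟨hx, y, hy, hyx⟩ => ⟨hx, y, h hy, hyx⟩

lemma upset_nonempty_iff (hS : S ⊆ Set.Icc 0 1) : (upset S).Nonempty ↔ S.Nonempty :=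
  ⟨fun ⟨_, _, y, hy, _⟩ => ⟨y, hy⟩, fun h => h.mono (subset_upset hS)⟩

lemma isCompact_upset (hS : IsClosed (upset S)) : IsCompact (upset S) :=
  isCompact_Icc.of_isClosed_subset hS upset_subset_Icc

lemma paretoFrontier_upset (hS : S ⊆ Set.Icc 0 1) :
    paretoFrontier (upset S) = paretoFrontier S := by
  ext x
  simp only [mem_paretoFrontier_iff_minimal]
  constructor
  · rintro ⟨⟨_, y, hy, hyx⟩, hmin⟩
    obtain rfl : x = y := le_antisymm (hmin (subset_upset hS hy) hyx) hyx
    exact ⟨hy, fun z hz => hmin (subset_upset hS hz)⟩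
  · rintro ⟨hx, hmin⟩
    exact ⟨subset_upset hS hx, fun z ⟨_, y, hy, hyz⟩ hzx => (hmin hy (hyz.trans hzx)).trans hyz⟩

lemma upset_paretoFrontier (hS : S ⊆ Set.Icc 0 1) (hc : IsClosed (upset S)) :
    upset (paretoFrontier S) = upset S := by
  refine (upset_mono paretoFrontier_subset).antisymm fun x hx => ?_
  obtain ⟨y, hyx, hy⟩ := exists_minimal_le_of_isCompact (isCompact_upset hc) hx
  refine ⟨hx.1, y, ?_, hyx⟩
  rwa [← paretoFrontier_upset hS, mem_paretoFrontier_iff_minimal]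

end Frontier

section Play

variable {m n : ℕ}

lemma measureReal_simplexMeasure_singleton {N : ℕ} (p : stdSimplex ℝ (Fin N)) (i : Fin N) :
    (simplexMeasure p).real {i} = p i := by
  have h : simplexMeasure p {i} = ENNReal.ofReal (p i) := by
    rw [simplexMeasure, Measure.finsetSum_apply, Finset.sum_eq_single i] <;> simp +contextual
  rw [measureReal_def, h]
  exact ENNReal.toReal_ofReal (p.2.1 i)

/-- The probability that the pair of actions `x` is played at stage `t` after the history `h`. -/
def stageProb (σ : AliceStrategy m n) (τ : BobStrategy m n) (t : ℕ) (h : History m n t)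
    (x : Fin m × Fin n) : ℝ :=
  σ t h x.1 * τ t h x.2

/-- The probability that the first `t` stages follow the history `h`: the product over the stages
of the probabilities of the actions of `h` given the preceding ones. -/
def pathProb (σ : AliceStrategy m n) (τ : BobStrategy m n) (t : ℕ) (h : History m n t) : ℝ :=
  ∏ i : Fin t, stageProb σ τ i (Fin.take i i.isLt.le h) (h i)

/-- The strategy that a player follows after the first stage, if `x` was played there. It is
defined for an arbitrary type `S` of stage decisions in order to apply to both players. -/
def continuation {S : Type*} (σ : (t : ℕ) → History m n t → S) (x : Fin m × Fin n) :
    (t : ℕ) → History m n t → S :=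
  fun t h => σ (t + 1) (Fin.cons x h)

/-- The history of the first `t` stages of an infinite play. -/
def playPrefix (t : ℕ) (ω : ℕ → Fin m × Fin n) : History m n t := fun i => ω i

variable (σ : AliceStrategy m n) (τ : BobStrategy m n)

lemma measureReal_stageLaw_singleton (t : ℕ) (h : History m n t) (x : Fin m × Fin n) :
    (stageLaw σ τ t h).real {x} = stageProb σ τ t h x := by
  obtain ⟨a, b⟩ := x
  rw [← Set.singleton_prod_singleton, stageLaw, measureReal_prod_prod,
    measureReal_simplexMeasure_singleton, measureReal_simplexMeasure_singleton, stageProb]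

lemma pathProb_succ (t : ℕ) (h : History m n (t + 1)) :
    pathProb σ τ (t + 1) h =
      pathProb σ τ t (Fin.init h) * stageProb σ τ t (Fin.init h) (h (Fin.last t)) :=
  Fin.prod_univ_castSucc _

lemma pathProb_cons (x : Fin m × Fin n) (t : ℕ) (h : History m n t) :
    pathProb σ τ (t + 1) (Fin.cons x h) =
      stageProb σ τ 0 Fin.elim0 x * pathProb (continuation σ x) (continuation τ x) t h := by
  have take_cons (i : Fin t) : Fin.take (i + 1) (Nat.succ_le_succ i.isLt.le)
      (Fin.cons x h : History m n (t + 1)) = Fin.cons x (Fin.take i i.isLt.le h) := by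
    ext j : 1
    cases j using Fin.cases <;> rfl
  rw [pathProb, Fin.prod_univ_succ]
  congr 1
  · exact congrArg (stageProb σ τ 0 · x) (Subsingleton.elim _ _)
  · exact Finset.prod_congr rfl fun i _ => congrArg (stageProb σ τ (i + 1) · (h i)) (take_cons i)

@[fun_prop]
lemma measurable_playPrefix (t : ℕ) : Measurable (playPrefix (m := m) (n := n) t) := by
  unfold playPrefix
  fun_prop

instance isProbabilityMeasure_playMeasure : IsProbabilityMeasure (playMeasure σ τ) := by
  unfold playMeasure
  infer_instance

lemma map_eval_zero_playMeasure :
    (playMeasure σ τ).map (fun ω => ω 0) = stageLaw σ τ 0 Fin.elim0 := by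
  have h : (fun ω : ℕ → Fin m × Fin n => ω 0) =
      (fun x : Finset.Iic 0 → Fin m × Fin n => x ⟨0, by simp⟩) ∘ Preorder.frestrictLe 0 := rfl
  rw [h, ← Measure.map_map (by fun_prop) (by fun_prop), playMeasure, Kernel.trajMeasure,
    Measure.map_comp _ _ (by fun_prop), Kernel.traj_map_frestrictLe, Kernel.partialTraj_self,
    Measure.id_comp, Measure.map_map (by fun_prop) (by fun_prop)]
  exact Measure.map_id

lemma playPrefix_succ_eq_iff {t : ℕ} {ω : ℕ → Fin m × Fin n} {h : History m n (t + 1)} :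
    playPrefix (t + 1) ω = h ↔ playPrefix t ω = Fin.init h ∧ ω t = h (Fin.last t) := by
  simp [playPrefix, funext_iff, Fin.forall_fin_succ', Fin.init]

lemma measureReal_playPrefix_one_eq (h : History m n 1) :
    (playMeasure σ τ).real {ω | playPrefix 1 ω = h} = pathProb σ τ 1 h := by
  have h_first : {ω | playPrefix 1 ω = h} = (fun ω => ω 0) ⁻¹' {h (Fin.last 0)} := by
    ext ω
    exact playPrefix_succ_eq_iff.trans (and_iff_right (Subsingleton.elim _ _))
  rw [h_first, ← map_measureReal_apply (by fun_prop) (measurableSet_singleton _),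
    map_eval_zero_playMeasure, measureReal_stageLaw_singleton, pathProb_succ, pathProb,
    Fin.prod_univ_zero, one_mul, Subsingleton.elim (Fin.init h)]

lemma measureReal_playPrefix_add_two_eq (t : ℕ) (h : History m n (t + 2)) :
    (playMeasure σ τ).real {ω | playPrefix (t + 2) ω = h} =
      (playMeasure σ τ).real {ω | playPrefix (t + 1) ω = Fin.init h} *
        stageProb σ τ (t + 1) (Fin.init h) (h (Fin.last (t + 1))) := by
  let toHistory (x : Finset.Iic t → Fin m × Fin n) : History m n (t + 1) :=
    fun i => x ⟨i, Finset.mem_Iic.mpr (Nat.lt_succ_iff.mp i.isLt)⟩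
  let past : Set (Finset.Iic t → Fin m × Fin n) := toHistory ⁻¹' {Fin.init h}
  have h_succ : {ω | playPrefix (t + 2) ω = h} =
      (fun ω => (Preorder.frestrictLe t ω, ω (t + 1))) ⁻¹' (past ×ˢ {h (Fin.last _)}) := by
    ext ω
    exact playPrefix_succ_eq_iff
  have h_law : ∀ x ∈ past, stageKernel σ τ t x {h (Fin.last _)} =
      stageLaw σ τ (t + 1) (Fin.init h) {h (Fin.last _)} := fun x hx => by
    rw [← Set.mem_singleton_iff.mp hx]
    rfl
  have h_joint := Kernel.map_frestrictLe_trajMeasure_compProd_eq_map_trajMeasure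
    (X := fun _ => Fin m × Fin n) (μ₀ := stageLaw σ τ 0 Fin.elim0) (κ := stageKernel σ τ)
    (a := t)
  rw [← measureReal_stageLaw_singleton, measureReal_def, measureReal_def, measureReal_def,
    ← ENNReal.toReal_mul, h_succ, ← Measure.map_apply (by fun_prop) (by measurability),
    playMeasure, ← h_joint, Measure.compProd_apply_prod (by measurability) (by measurability),
    setLIntegral_congr_fun (by measurability) h_law, setLIntegral_const,
    Measure.map_apply (by fun_prop) (by measurability), mul_comm]
  rfl

lemma measureReal_playPrefix_eq (t : ℕ) (h : History m n t) :
    (playMeasure σ τ).real {ω | playPrefix t ω = h} = pathProb σ τ t h := by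
  induction t with
  | zero =>
    have h_univ : {ω : ℕ → Fin m × Fin n | playPrefix 0 ω = h} = Set.univ :=
      Set.eq_univ_of_forall fun _ => Subsingleton.elim _ _
    rw [h_univ, probReal_univ, pathProb, Fin.prod_univ_zero]
  | succ t ih =>
    cases t with
    | zero => exact measureReal_playPrefix_one_eq σ τ h
    | succ t => rw [measureReal_playPrefix_add_two_eq, ih, ← pathProb_succ]

lemma integral_playPrefix (t : ℕ) (g : History m n t → ℝ) :
    ∫ ω, g (playPrefix t ω) ∂playMeasure σ τ = ∑ h, pathProb σ τ t h * g h := by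
  have : IsProbabilityMeasure ((playMeasure σ τ).map (playPrefix t)) :=
    Measure.isProbabilityMeasure_map (by fun_prop)
  rw [← integral_map (by fun_prop) (Measurable.of_discrete (f := g)).aestronglyMeasurable,
    integral_fintype Integrable.of_finite]
  refine Finset.sum_congr rfl fun h _ => ?_
  rw [map_measureReal_apply (by fun_prop) (measurableSet_singleton h), smul_eq_mul,
    ← measureReal_playPrefix_eq]
  rfl

lemma integral_playPrefix_succ (t : ℕ) (g : History m n (t + 1) → ℝ) :
    ∫ ω, g (playPrefix (t + 1) ω) ∂playMeasure σ τ =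
      ∑ x, stageProb σ τ 0 Fin.elim0 x *
        ∫ ω, g (Fin.cons x (playPrefix t ω))
          ∂playMeasure (continuation σ x) (continuation τ x) := by
  rw [integral_playPrefix, ← (Fin.consEquiv fun _ => Fin m × Fin n).sum_comp,
    Fintype.sum_prod_type]
  refine Finset.sum_congr rfl fun x _ => ?_
  rw [integral_playPrefix _ _ t fun h => g (Fin.cons x h), Finset.mul_sum]
  refine Finset.sum_congr rfl fun h _ => ?_
  exact (congrArg (· * _) (pathProb_cons σ τ x t h)).trans (mul_assoc _ _ _)

end Play

section Discounting

variable {β : ℝ}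

lemma summable_pow_mul_of_abs_le (hβ : |β| < 1) {f : ℕ → ℝ} {C : ℝ} (hf : ∀ t, |f t| ≤ C) :
    Summable fun t => β ^ t * f t := by
  refine .of_norm_bounded ((summable_geometric_of_abs_lt_one (abs_abs β ▸ hβ)).mul_right C)
    fun t => ?_
  rw [Real.norm_eq_abs, abs_mul, abs_pow]
  gcongr
  exact hf t

lemma tsum_pow_mul_mem_Icc (hβ : β ∈ Set.Ico (0 : ℝ) 1) {f : ℕ → ℝ}
    (hf : ∀ t, f t ∈ Set.Icc 0 (1 - β)) : ∑' t, β ^ t * f t ∈ Set.Icc (0 : ℝ) 1 := by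
  refine ⟨tsum_nonneg fun t => mul_nonneg (pow_nonneg hβ.1 t) (hf t).1, ?_⟩
  have hf_abs (t : ℕ) : |f t| ≤ 1 - β := (abs_of_nonneg (hf t).1).trans_le (hf t).2
  calc ∑' t, β ^ t * f t
      ≤ ∑' t, β ^ t * (1 - β) :=
        (summable_pow_mul_of_abs_le ((abs_of_nonneg hβ.1).trans_lt hβ.2) hf_abs).tsum_le_tsum
          (fun t => mul_le_mul_of_nonneg_left (hf t).2 (pow_nonneg hβ.1 t))
          ((summable_geometric_of_lt_one hβ.1 hβ.2).mul_right _)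
    _ = 1 := by
        rw [tsum_mul_right, tsum_geometric_of_lt_one hβ.1 hβ.2,
          inv_mul_cancel₀ (sub_pos.mpr hβ.2).ne']

lemma integral_tsum_pow_mul {X : Type*} [Finite X] [MeasurableSpace X]
    [DiscreteMeasurableSpace X] (μ : Measure (ℕ → X)) [IsFiniteMeasure μ] (hβ : |β| < 1)
    (f : X → ℝ) :
    ∫ ω, ∑' t, β ^ t * f (ω t) ∂μ = ∑' t, β ^ t * ∫ ω, f (ω t) ∂μ := by
  cases nonempty_fintype X
  have hf (t : ℕ) (ω : ℕ → X) : ‖f (ω t)‖ ≤ ‖f‖ := norm_le_pi_norm f _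
  have h_int (t : ℕ) : Integrable (fun ω : ℕ → X => f (ω t)) μ :=
    .of_bound (Measurable.of_discrete.comp (measurable_pi_apply t)).aestronglyMeasurable ‖f‖
      (.of_forall (hf t))
  rw [← integral_tsum_of_summable_integral_norm (fun t => (h_int t).const_mul (β ^ t))]
  · simp only [integral_const_mul]
  · simp only [norm_mul, integral_const_mul, norm_pow]
    refine summable_pow_mul_of_abs_le ?_ (C := ‖f‖ * μ.real Set.univ) fun t => ?_
    · rwa [Real.norm_eq_abs, abs_abs]
    · have h := norm_integral_le_of_norm_le_const (μ := μ) (f := fun ω => ‖f (ω t)‖)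
        (.of_forall fun ω => (norm_norm _).trans_le (hf t ω))
      rwa [Real.norm_eq_abs] at h

lemma le_of_forall_le_add_pow (hβ : |β| < 1) {x y : ℝ} (h : ∀ t : ℕ, x ≤ y + β ^ t) : x ≤ y := by
  have h_lim : Tendsto (fun t : ℕ => y + β ^ t) atTop (𝓝 (y + 0)) :=
    tendsto_const_nhds.add (tendsto_pow_atTop_nhds_zero_of_abs_lt_one hβ)
  rw [add_zero] at h_lim
  exact ge_of_tendsto' h_lim h

end Discounting

section Loss

variable {m n K : ℕ} {β : ℝ} (r : Fin m → Fin n → Fin K → ℝ)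

lemma expectedLoss_mem_Icc {r : Fin m → Fin n → Fin K → ℝ} (hβ : β ∈ Set.Ico (0 : ℝ) 1)
    (hr : ∀ a b k, r a b k ∈ Set.Icc 0 (1 - β)) (σ : AliceStrategy m n) (τ : BobStrategy m n)
    (k : Fin K) : expectedLoss β r σ τ k ∈ Set.Icc (0 : ℝ) 1 := by
  have h (ω : ℕ → Fin m × Fin n) := tsum_pow_mul_mem_Icc hβ fun t => hr (ω t).1 (ω t).2 k
  refine ⟨integral_nonneg fun ω => (h ω).1, ?_⟩
  refine (integral_mono_of_nonneg (.of_forall fun ω => (h ω).1) (integrable_const 1)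
    (.of_forall fun ω => (h ω).2)).trans_eq ?_
  rw [integral_const, probReal_univ, one_smul]

lemma expectedLoss_eq_tsum (hβ : |β| < 1) (σ : AliceStrategy m n) (τ : BobStrategy m n)
    (k : Fin K) : expectedLoss β r σ τ k =
      ∑' t : ℕ, β ^ t * ∫ ω, r (ω t).1 (ω t).2 k ∂playMeasure σ τ :=
  integral_tsum_pow_mul (playMeasure σ τ) hβ fun x => r x.1 x.2 k

lemma exists_forall_abs_integral_loss_le (k : Fin K) : ∃ C, ∀ (σ : AliceStrategy m n)
    (τ : BobStrategy m n) (t : ℕ), |∫ ω, r (ω t).1 (ω t).2 k ∂playMeasure σ τ| ≤ C := by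
  refine ⟨‖fun x : Fin m × Fin n => r x.1 x.2 k‖, fun σ τ t => ?_⟩
  have h := norm_integral_le_of_norm_le_const (μ := playMeasure σ τ) (.of_forall fun ω =>
    norm_le_pi_norm (fun x : Fin m × Fin n => r x.1 x.2 k) (ω t))
  rwa [probReal_univ, mul_one] at h

lemma continuous_expectedLoss (hβ : |β| < 1) (σ : AliceStrategy m n) (k : Fin K) :
    Continuous fun τ : BobStrategy m n => expectedLoss β r σ τ k := by
  have h_path (t : ℕ) (h : History m n t) : Continuous fun τ => pathProb σ τ t h := by
    unfold pathProb stageProb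
    refine continuous_finsetProd _ fun i _ => continuous_const.mul ?_
    exact (continuous_apply _).comp (continuous_subtype_val.comp
      ((continuous_apply _).comp (continuous_apply i.1)))
  have h_stage (t : ℕ) :
      Continuous fun τ => ∫ ω, r (ω t).1 (ω t).2 k ∂playMeasure σ τ := by
    have h_sum (τ) := integral_playPrefix σ τ (t + 1) fun h => r (h (.last t)).1 (h (.last t)).2 k
    exact (continuous_congr h_sum).mpr
      (continuous_finsetSum _ fun h _ => (h_path _ h).mul continuous_const)
  obtain ⟨C, hC⟩ := exists_forall_abs_integral_loss_le r k
  simp only [expectedLoss_eq_tsum r hβ]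
  refine continuous_tsum (fun t => continuous_const.mul (h_stage t))
    ((summable_geometric_of_abs_lt_one (abs_abs β ▸ hβ)).mul_right C) fun t τ => ?_
  rw [Real.norm_eq_abs, abs_mul, abs_pow]
  gcongr
  exact hC σ τ t

lemma exists_isGreatest_expectedLoss [Nonempty (Fin n)] (hβ : |β| < 1) (σ : AliceStrategy m n)
    (k : Fin K) :
    ∃ c, IsGreatest (Set.range fun τ : BobStrategy m n => expectedLoss β r σ τ k) c :=
  (isCompact_range (continuous_expectedLoss r hβ σ k)).exists_isGreatest (Set.range_nonempty _)

lemma integral_loss_zero (σ : AliceStrategy m n) (τ : BobStrategy m n) (k : Fin K) :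
    ∫ ω, r (ω 0).1 (ω 0).2 k ∂playMeasure σ τ =
      ∑ x, stageProb σ τ 0 Fin.elim0 x * r x.1 x.2 k := by
  refine (integral_playPrefix_succ σ τ 0 fun h => r (h 0).1 (h 0).2 k).trans ?_
  simp only [Fin.cons_zero, integral_const, probReal_univ, one_smul]

lemma integral_loss_succ (σ : AliceStrategy m n) (τ : BobStrategy m n) (t : ℕ) (k : Fin K) :
    ∫ ω, r (ω (t + 1)).1 (ω (t + 1)).2 k ∂playMeasure σ τ =
      ∑ x, stageProb σ τ 0 Fin.elim0 x *
        ∫ ω, r (ω t).1 (ω t).2 k ∂playMeasure (continuation σ x) (continuation τ x) :=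
  integral_playPrefix_succ σ τ (t + 1) fun h => r (h (Fin.last _)).1 (h (Fin.last _)).2 k

lemma expectedLoss_eq_sum_stageProb (hβ : |β| < 1) (σ : AliceStrategy m n) (τ : BobStrategy m n)
    (k : Fin K) :
    expectedLoss β r σ τ k = ∑ x, stageProb σ τ 0 Fin.elim0 x *
      (r x.1 x.2 k + β * expectedLoss β r (continuation σ x) (continuation τ x) k) := by
  obtain ⟨C, hC⟩ := exists_forall_abs_integral_loss_le r k
  have h_summable (σ : AliceStrategy m n) (τ : BobStrategy m n) :=
    summable_pow_mul_of_abs_le hβ (hC σ τ)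
  have h_tail (t : ℕ) : β ^ (t + 1) * ∫ ω, r (ω (t + 1)).1 (ω (t + 1)).2 k ∂playMeasure σ τ =
      ∑ x, stageProb σ τ 0 Fin.elim0 x * (β * (β ^ t *
        ∫ ω, r (ω t).1 (ω t).2 k ∂playMeasure (continuation σ x) (continuation τ x))) := by
    rw [integral_loss_succ, Finset.mul_sum]
    exact Finset.sum_congr rfl fun x _ => by ring
  simp only [expectedLoss_eq_tsum r hβ]
  rw [(h_summable σ τ).tsum_eq_zero_add, tsum_congr h_tail,
    Summable.tsum_finsetSum fun x _ => ((h_summable _ _).mul_left β).mul_left _]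
  simp only [tsum_mul_left, pow_zero, one_mul, integral_loss_zero, mul_add,
    Finset.sum_add_distrib]

end Loss

section OneStage

variable {m n K : ℕ} {β : ℝ} {r : Fin m → Fin n → Fin K → ℝ} {U V : Set (Fin K → ℝ)}
  {α : Fin m → ℝ} {R R' : Fin m → Fin n → Fin K → ℝ}

lemma sum_stdSimplex_mul_le {ι : Type*} [Fintype ι] {p f : ι → ℝ} {c : ℝ}
    (hp : p ∈ stdSimplex ℝ ι) (h : ∀ i, f i ≤ c) : ∑ i, p i * f i ≤ c :=
  calc ∑ i, p i * f i ≤ ∑ i, p i * c :=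
        Finset.sum_le_sum fun i _ => mul_le_mul_of_nonneg_left (h i) (hp.1 i)
    _ = c := by rw [← Finset.sum_mul, hp.2, one_mul]

lemma exists_isGreatest_range_le_iff {ι κ E : Type*} [Preorder E] {f : ι → κ → E} {x : κ → E}
    (hf : ∀ k, ∃ c, IsGreatest (Set.range fun i => f i k) c) :
    (∃ u : κ → E, (∀ k, IsGreatest (Set.range fun i => f i k) (u k)) ∧ u ≤ x) ↔
      ∀ i, f i ≤ x := by
  refine ⟨fun ⟨u, hu, hux⟩ i k => ((hu k).2 ⟨i, rfl⟩).trans (hux k), fun h => ?_⟩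
  choose u hu using hf
  refine ⟨u, hu, fun k => ?_⟩
  obtain ⟨i, hi⟩ := (hu k).1
  exact hi.symm.trans_le (h i k)

lemma mem_Icc_of_forall_isGreatest_range {ι κ E : Type*} [Preorder E] {f : ι → κ → E}
    {l u x : κ → E} (hf : ∀ i, f i ∈ Set.Icc l u)
    (hx : ∀ k, IsGreatest (Set.range fun i => f i k) (x k)) : x ∈ Set.Icc l u := by
  choose i hi using fun k => (hx k).1
  exact ⟨fun k => ((hf (i k)).1 k).trans_eq (hi k), fun k => (hi k).symm.trans_le ((hf (i k)).2 k)⟩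

/-- The expected loss vector of a stage in which Alice mixes according to `α` and Bob plays `b`,
followed by the continuation loss `R a b` after the actions `a` and `b`. -/
def stageCost (β : ℝ) (r : Fin m → Fin n → Fin K → ℝ) (α : Fin m → ℝ)
    (R : Fin m → Fin n → Fin K → ℝ) (b : Fin n) : Fin K → ℝ :=
  fun k => ∑ a, α a * (r a b k + β * R a b k)

lemma stageCost_mem_Icc (hβ : β ∈ Set.Ico (0 : ℝ) 1) (hr : ∀ a b k, r a b k ∈ Set.Icc 0 (1 - β))
    (hα : α ∈ stdSimplex ℝ (Fin m)) (hR : ∀ a b, R a b ∈ Set.Icc 0 1) (b : Fin n) :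
    stageCost β r α R b ∈ Set.Icc 0 1 := by
  refine ⟨fun k => Finset.sum_nonneg fun a _ => mul_nonneg (hα.1 a)
    (add_nonneg (hr a b k).1 (mul_nonneg hβ.1 ((hR a b).1 k))), fun k =>
    sum_stdSimplex_mul_le hα fun a => ?_⟩
  calc r a b k + β * R a b k ≤ (1 - β) + β * 1 :=
        add_le_add (hr a b k).2 (mul_le_mul_of_nonneg_left ((hR a b).2 k) hβ.1)
    _ = 1 := by ring

lemma stageCost_le_add (hβ : 0 ≤ β) (hα : α ∈ stdSimplex ℝ (Fin m)) {ε : ℝ} {b : Fin n}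
    {k : Fin K} (h : ∀ a, R a b k ≤ R' a b k + ε) :
    stageCost β r α R b k ≤ stageCost β r α R' b k + β * ε :=
  calc stageCost β r α R b k
      ≤ ∑ a, α a * ((r a b k + β * R' a b k) + β * ε) := by
        refine Finset.sum_le_sum fun a _ => mul_le_mul_of_nonneg_left ?_ (hα.1 a)
        rw [add_assoc, ← mul_add]
        gcongr
        exact h a
    _ = stageCost β r α R' b k + β * ε := by
        simp only [mul_add _ _ (β * ε), Finset.sum_add_distrib, ← Finset.sum_mul, hα.2, one_mul,
          stageCost]

lemma stageCost_mono (hβ : 0 ≤ β) (hα : α ∈ stdSimplex ℝ (Fin m)) {b : Fin n}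
    (h : ∀ a, R a b ≤ R' a b) : stageCost β r α R b ≤ stageCost β r α R' b := fun k => by
  simpa only [mul_zero, add_zero] using
    stageCost_le_add hβ hα (ε := 0) fun a => (h a k).trans_eq (add_zero _).symm

/-- The monotone operator on sets of loss vectors that replaces the dynamic programming operator:
upsets, unlike Pareto frontiers, are compared by inclusion. It consists of the vectors in `[0,1]^K`
that Alice can secure in one stage with continuation losses in `U`. -/
def stepUpset (β : ℝ) (r : Fin m → Fin n → Fin K → ℝ) (U : Set (Fin K → ℝ)) :
    Set (Fin K → ℝ) :=
  upset (preOperator β r U)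

lemma mem_stepUpset_iff [Nonempty (Fin n)] {x : Fin K → ℝ} : x ∈ stepUpset β r U ↔
    x ∈ Set.Icc 0 1 ∧ ∃ α ∈ stdSimplex ℝ (Fin m), ∃ R : Fin m → Fin n → Fin K → ℝ,
      (∀ a b, R a b ∈ U) ∧ ∀ b, stageCost β r α R b ≤ x := by
  have h_max (α : Fin m → ℝ) (R : Fin m → Fin n → Fin K → ℝ) (k : Fin K) :
      ∃ c, IsGreatest (Set.range fun b => stageCost β r α R b k) c :=
    (Set.finite_range _).isCompact.exists_isGreatest (Set.range_nonempty _)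
  simp only [← exists_isGreatest_range_le_iff (h_max _ _)]
  refine and_congr_right fun _ => ⟨?_, ?_⟩
  · rintro ⟨u, ⟨α, hα, R, hR, hu⟩, hux⟩
    exact ⟨α, hα, R, hR, u, hu, hux⟩
  · rintro ⟨α, hα, R, hR, u, hu, hux⟩
    exact ⟨u, ⟨α, hα, R, hR, hu⟩, hux⟩

lemma stepUpset_subset_Icc : stepUpset β r U ⊆ Set.Icc 0 1 := upset_subset_Icc

lemma preOperator_subset_Icc (hβ : β ∈ Set.Ico (0 : ℝ) 1)
    (hr : ∀ a b k, r a b k ∈ Set.Icc 0 (1 - β)) (hV : V ⊆ Set.Icc 0 1) :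
    preOperator β r V ⊆ Set.Icc 0 1 := by
  rintro u ⟨α, hα, R, hR, hu⟩
  exact mem_Icc_of_forall_isGreatest_range
    (fun b => stageCost_mem_Icc hβ hr hα (fun a b => hV (hR a b)) b) hu

lemma stepUpset_mono (h : U ⊆ V) : stepUpset β r U ⊆ stepUpset β r V :=
  upset_mono fun _ ⟨α, hα, R, hR, hu⟩ => ⟨α, hα, R, fun a b => h (hR a b), hu⟩

lemma one_mem_stepUpset [Nonempty (Fin m)] [Nonempty (Fin n)] (hβ : β ∈ Set.Ico (0 : ℝ) 1)
    (hr : ∀ a b k, r a b k ∈ Set.Icc 0 (1 - β)) (hU : U ⊆ Set.Icc 0 1) (hne : U.Nonempty) :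
    (1 : Fin K → ℝ) ∈ stepUpset β r U := by
  obtain ⟨y, hy⟩ := hne
  obtain ⟨a⟩ := ‹Nonempty (Fin m)›
  have hα := single_mem_stdSimplex ℝ a
  exact mem_stepUpset_iff.mpr ⟨⟨zero_le_one, le_rfl⟩, _, hα, fun _ _ => y, fun _ _ => hy,
    fun b => (stageCost_mem_Icc hβ hr hα (fun _ _ => hU hy) b).2⟩

lemma stepUpset_upset [Nonempty (Fin n)] (hβ : 0 ≤ β) (hV : V ⊆ Set.Icc 0 1) :
    stepUpset β r (upset V) = stepUpset β r V := by
  refine subset_antisymm (fun x hx => ?_) (stepUpset_mono (subset_upset hV))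
  obtain ⟨hx, α, hα, R, hR, hRx⟩ := mem_stepUpset_iff.mp hx
  choose R' hR' hR'R using fun a b => (hR a b).2
  exact mem_stepUpset_iff.mpr ⟨hx, α, hα, R', hR', fun b =>
    (stageCost_mono hβ hα fun a => hR'R a b).trans (hRx b)⟩

lemma convex_stepUpset [Nonempty (Fin n)] (hU : Convex ℝ U) : Convex ℝ (stepUpset β r U) := by
  intro x hx y hy p q hp hq hpq
  obtain ⟨hx, α, hα, R, hR, hRx⟩ := mem_stepUpset_iff.mp hx
  obtain ⟨hy, α', hα', R', hR', hRy⟩ := mem_stepUpset_iff.mp hy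
  choose Q hQ hQ_eq using fun a b => hU.exists_mem_add_smul_eq (hR a b) (hR' a b)
    (mul_nonneg hp (hα.1 a)) (mul_nonneg hq (hα'.1 a))
  have h_cost (b : Fin n) : stageCost β r (p • α + q • α') Q b =
      p • stageCost β r α R b + q • stageCost β r α' R' b := by
    ext k
    simp only [stageCost, Pi.add_apply, Pi.smul_apply, smul_eq_mul, Finset.mul_sum,
      ← Finset.sum_add_distrib]
    refine Finset.sum_congr rfl fun a _ => ?_
    have h := congrFun (hQ_eq a b) k
    simp only [Pi.add_apply, Pi.smul_apply, smul_eq_mul] at h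
    linear_combination β * h
  refine mem_stepUpset_iff.mpr ⟨convex_Icc 0 1 hx hy hp hq hpq, p • α + q • α',
    convex_stdSimplex ℝ _ hα hα' hp hq hpq, Q, hQ, fun b => (h_cost b).trans_le ?_⟩
  gcongr
  exacts [hRx b, hRy b]

lemma isClosed_stepUpset [Nonempty (Fin n)] (hU : IsCompact U) :
    IsClosed (stepUpset β r U) := by
  let C : Set ((Fin K → ℝ) × (Fin m → ℝ) × (Fin m → Fin n → Fin K → ℝ)) :=
    (Set.Icc 0 1 ×ˢ stdSimplex ℝ (Fin m) ×ˢ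
      Set.pi Set.univ fun _ => Set.pi Set.univ fun _ => U) ∩
    {z | ∀ b, stageCost β r z.2.1 z.2.2 b ≤ z.1}
  have hC : IsCompact C := by
    refine (isCompact_Icc.prod ((isCompact_stdSimplex ℝ _).prod
      (isCompact_univ_pi fun _ => isCompact_univ_pi fun _ => hU))).inter_right ?_
    simp only [Set.ofPred_forall]
    refine isClosed_iInter fun b => isClosed_le ?_ continuous_fst
    unfold stageCost
    fun_prop
  have h_image : stepUpset β r U = Prod.fst '' C := by
    ext x
    rw [mem_stepUpset_iff]
    constructor
    · rintro ⟨hx, α, hα, R, hR, hRx⟩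
      exact ⟨(x, α, R), ⟨⟨hx, hα, fun a _ b _ => hR a b⟩, hRx⟩, rfl⟩
    · rintro ⟨⟨x, α, R⟩, ⟨⟨hx, hα, hR⟩, hRx⟩, rfl⟩
      exact ⟨hx, α, hα, R, fun a b => hR a trivial b trivial, hRx⟩
  exact h_image ▸ (hC.image continuous_fst).isClosed

end OneStage

section Comparison

variable {m n K : ℕ} {β c : ℝ} {r : Fin m → Fin n → Fin K → ℝ} {U V : Set (Fin K → ℝ)}
  {x : Fin K → ℝ}

/-- The translate of `x` by `c` in every component, truncated so as to stay in `[0,1]^K`. -/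
def truncatedTranslate (c : ℝ) (x : Fin K → ℝ) : Fin K → ℝ := fun k => min (x k + c) 1

lemma truncatedTranslate_mem_Icc (hc : 0 ≤ c) (hx : 0 ≤ x) :
    truncatedTranslate c x ∈ Set.Icc 0 1 :=
  ⟨fun k => le_min (add_nonneg (hx k) hc) zero_le_one, fun _ => min_le_right _ _⟩

lemma tendsto_truncatedTranslate_pow (hβ : |β| < 1) (hx : x ≤ 1) :
    Tendsto (fun t : ℕ => truncatedTranslate (β ^ t) x) atTop (𝓝 x) := by
  have h_cont : Continuous fun c => truncatedTranslate c x := by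
    unfold truncatedTranslate
    fun_prop
  refine (h_cont.tendsto' 0 x ?_).comp (tendsto_pow_atTop_nhds_zero_of_abs_lt_one hβ)
  ext k
  exact (congrArg (min · 1) (add_zero (x k))).trans (min_eq_left (hx k))

lemma truncatedTranslate_mem_stepUpset [Nonempty (Fin n)] (hβ : β ∈ Set.Ico (0 : ℝ) 1)
    (hr : ∀ a b k, r a b k ∈ Set.Icc 0 (1 - β)) (hV : V ⊆ Set.Icc 0 1) (hc : 0 ≤ c)
    (hUV : ∀ y ∈ U, truncatedTranslate c y ∈ V) (hx : x ∈ stepUpset β r U) :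
    truncatedTranslate (β * c) x ∈ stepUpset β r V := by
  obtain ⟨hx, α, hα, R, hR, hRx⟩ := mem_stepUpset_iff.mp hx
  have hR_mem (a : Fin m) (b : Fin n) := hUV _ (hR a b)
  refine mem_stepUpset_iff.mpr ⟨truncatedTranslate_mem_Icc (mul_nonneg hβ.1 hc) hx.1, α, hα, _,
    hR_mem, fun b k => le_min ?_ ((stageCost_mem_Icc hβ hr hα (fun a b => hV (hR_mem a b)) b).2 k)⟩
  exact (stageCost_le_add hβ.1 hα fun a => min_le_left _ _).trans (add_le_add_left (hRx b k) _)

lemma subset_of_subset_stepUpset_of_stepUpset_subset [Nonempty (Fin m)] [Nonempty (Fin n)]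
    (hβ : β ∈ Set.Ico (0 : ℝ) 1) (hr : ∀ a b k, r a b k ∈ Set.Icc 0 (1 - β))
    (hU : U ⊆ stepUpset β r U) (hV : stepUpset β r V ⊆ V) (hV_Icc : V ⊆ Set.Icc 0 1)
    (hV_ne : V.Nonempty) (hV_closed : IsClosed V) : U ⊆ V := by
  have hU_Icc := hU.trans stepUpset_subset_Icc
  have h_translate (t : ℕ) : ∀ x ∈ U, truncatedTranslate (β ^ t) x ∈ V := by
    induction t with
    | zero =>
      intro x hx
      have h_one : truncatedTranslate (β ^ 0) x = 1 :=
        funext fun k => min_eq_right (le_add_of_nonneg_left ((hU_Icc hx).1 k))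
      exact h_one ▸ hV (one_mem_stepUpset hβ hr hV_Icc hV_ne)
    | succ t ih =>
      intro x hx
      rw [pow_succ']
      exact hV (truncatedTranslate_mem_stepUpset hβ hr hV_Icc (pow_nonneg hβ.1 t) ih (hU hx))
  exact fun x hx => hV_closed.mem_of_tendsto
    (tendsto_truncatedTranslate_pow ((abs_of_nonneg hβ.1).trans_lt hβ.2) (hU_Icc hx).2)
    (.of_forall fun t => h_translate t x hx)

end Comparison

section SecuredSet

variable {m n K : ℕ} {β : ℝ} {r : Fin m → Fin n → Fin K → ℝ} {U V : Set (Fin K → ℝ)}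

lemma expectedLoss_eq_sum_stageCost (hβ : |β| < 1) (σ : AliceStrategy m n)
    (τ : BobStrategy m n) (k : Fin K) :
    expectedLoss β r σ τ k = ∑ b, τ 0 Fin.elim0 b * stageCost β r (σ 0 Fin.elim0)
      (fun a b => expectedLoss β r (continuation σ (a, b)) (continuation τ (a, b))) b k := by
  rw [expectedLoss_eq_sum_stageProb r hβ, Fintype.sum_prod_type_right]
  refine Finset.sum_congr rfl fun b _ => ?_
  rw [stageCost, Finset.mul_sum]
  refine Finset.sum_congr rfl fun a _ => ?_
  rw [stageProb]
  ring

/-- The strategy that starts with the decision `s` and continues with `σ x` if the pair of actions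
`x` is played at the first stage; it is a right inverse of `continuation`. -/
def prepend {S : Type*} (s : S) (σ : Fin m × Fin n → (t : ℕ) → History m n t → S) :
    (t : ℕ) → History m n t → S
  | 0, _ => s
  | t + 1, h => σ (h 0) t (Fin.tail h)

lemma expectedLoss_prepend_vertex (hβ : |β| < 1) (σ : AliceStrategy m n) (b : Fin n)
    (τ : Fin m × Fin n → BobStrategy m n) (k : Fin K) :
    expectedLoss β r σ (prepend (stdSimplex.vertex b) τ) k = stageCost β r (σ 0 Fin.elim0)
      (fun a b => expectedLoss β r (continuation σ (a, b)) (τ (a, b))) b k := by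
  rw [expectedLoss_eq_sum_stageCost hβ]
  simp only [prepend, stdSimplex.vertex_coe, Pi.single_apply, ite_mul, one_mul, zero_mul,
    Finset.sum_ite_eq', Finset.mem_univ, if_true]
  rfl

/-- Alice's strategy with set of states `S` and initial state `s`: she mixes according to `α s` in
the state `s` and moves to the state `next s x` after the pair of actions `x`. -/
def stateStrategy {S : Type*} (α : S → stdSimplex ℝ (Fin m)) (next : S → Fin m × Fin n → S)
    (s : S) : AliceStrategy m n
  | 0, _ => α s
  | t + 1, h => stateStrategy α next (next s (h 0)) t (Fin.tail h)

lemma expectedLoss_stateStrategy_le {S : Type*} {α : S → stdSimplex ℝ (Fin m)}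
    {next : S → Fin m × Fin n → S} {v : S → Fin K → ℝ} (hβ : β ∈ Set.Ico (0 : ℝ) 1)
    (hr : ∀ a b k, r a b k ∈ Set.Icc 0 (1 - β)) (hv : ∀ s, 0 ≤ v s)
    (h : ∀ s b, stageCost β r (α s) (fun a b => v (next s (a, b))) b ≤ v s)
    (s : S) (τ : BobStrategy m n) (k : Fin K) :
    expectedLoss β r (stateStrategy α next s) τ k ≤ v s k := by
  have hβ_abs := (abs_of_nonneg hβ.1).trans_lt hβ.2
  refine le_of_forall_le_add_pow hβ_abs fun t => ?_
  induction t generalizing s τ with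
  | zero => exact (expectedLoss_mem_Icc hβ hr _ τ k).2.trans (le_add_of_nonneg_left (hv s k))
  | succ t ih =>
    rw [expectedLoss_eq_sum_stageCost hβ_abs]
    refine sum_stdSimplex_mul_le (τ 0 Fin.elim0).2 fun b => ?_
    rw [pow_succ']
    exact (stageCost_le_add hβ.1 (α s).2 fun a => ih (next s (a, b)) _).trans
      (add_le_add_left (h s b k) _)

/-- The vectors in `[0,1]^K` that Alice can secure in the infinitely repeated game. -/
def securedSet (β : ℝ) (r : Fin m → Fin n → Fin K → ℝ) : Set (Fin K → ℝ) :=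
  upset (guarantees β r)

lemma mem_securedSet_iff [Nonempty (Fin n)] (hβ : |β| < 1) {x : Fin K → ℝ} :
    x ∈ securedSet β r ↔ x ∈ Set.Icc 0 1 ∧
      ∃ σ : AliceStrategy m n, ∀ τ : BobStrategy m n, expectedLoss β r σ τ ≤ x := by
  simp only [← exists_isGreatest_range_le_iff (exists_isGreatest_expectedLoss r hβ _)]
  refine and_congr_right fun _ => ⟨?_, ?_⟩
  · rintro ⟨u, ⟨σ, hu⟩, hux⟩
    exact ⟨σ, u, hu, hux⟩
  · rintro ⟨σ, u, hu, hux⟩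
    exact ⟨u, ⟨σ, hu⟩, hux⟩

lemma guarantees_subset_Icc (hβ : β ∈ Set.Ico (0 : ℝ) 1)
    (hr : ∀ a b k, r a b k ∈ Set.Icc 0 (1 - β)) : guarantees β r ⊆ Set.Icc 0 1 := by
  rintro w ⟨σ, hw⟩
  have h_loss (τ : BobStrategy m n) : expectedLoss β r σ τ ∈ Set.Icc 0 1 :=
    ⟨fun k => (expectedLoss_mem_Icc hβ hr σ τ k).1, fun k => (expectedLoss_mem_Icc hβ hr σ τ k).2⟩
  exact mem_Icc_of_forall_isGreatest_range h_loss hw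

lemma securedSet_subset_Icc : securedSet β r ⊆ Set.Icc 0 1 := upset_subset_Icc

lemma optimalFrontier_subset_Icc (hβ : β ∈ Set.Ico (0 : ℝ) 1)
    (hr : ∀ a b k, r a b k ∈ Set.Icc 0 (1 - β)) : optimalFrontier β r ⊆ Set.Icc 0 1 :=
  paretoFrontier_subset.trans (guarantees_subset_Icc hβ hr)

lemma paretoFrontier_securedSet (hβ : β ∈ Set.Ico (0 : ℝ) 1)
    (hr : ∀ a b k, r a b k ∈ Set.Icc 0 (1 - β)) :
    paretoFrontier (securedSet β r) = optimalFrontier β r :=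
  paretoFrontier_upset (guarantees_subset_Icc hβ hr)

variable [Nonempty (Fin n)] (hβ : β ∈ Set.Ico (0 : ℝ) 1)
  (hr : ∀ a b k, r a b k ∈ Set.Icc 0 (1 - β))

include hβ hr

lemma subset_securedSet (hU : U ⊆ stepUpset β r U) : U ⊆ securedSet β r := by
  choose hU_Icc α hα R hR hRx using fun x : U => mem_stepUpset_iff.mp (hU x.2)
  exact fun x hx => (mem_securedSet_iff ((abs_of_nonneg hβ.1).trans_lt hβ.2)).mpr
    ⟨hU_Icc ⟨x, hx⟩, _, fun τ k => expectedLoss_stateStrategy_le (α := fun y => ⟨α y, hα y⟩)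
      (next := fun y ab => ⟨R y ab.1 ab.2, hR y ab.1 ab.2⟩) (v := Subtype.val) hβ hr
      (fun y => (hU_Icc y).1) hRx ⟨x, hx⟩ τ k⟩

lemma securedSet_subset_stepUpset : securedSet β r ⊆ stepUpset β r (securedSet β r) := by
  have hβ_abs := (abs_of_nonneg hβ.1).trans_lt hβ.2
  intro x hx
  obtain ⟨hx, σ, hσ⟩ := (mem_securedSet_iff hβ_abs).mp hx
  choose R hR using fun a b => exists_isGreatest_expectedLoss r hβ_abs (continuation σ (a, b))
  choose τ hτ using fun a b k => (hR a b k).1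
  have hR_mem (a : Fin m) (b : Fin n) : R a b ∈ guarantees β r := ⟨continuation σ (a, b), hR a b⟩
  refine mem_stepUpset_iff.mpr ⟨hx, σ 0 Fin.elim0, (σ 0 Fin.elim0).2, R, fun a b =>
    subset_upset (guarantees_subset_Icc hβ hr) (hR_mem a b), fun b k => ?_⟩
  calc stageCost β r (σ 0 Fin.elim0) R b k
      = expectedLoss β r σ (prepend (stdSimplex.vertex b) fun ab => τ ab.1 ab.2 k) k := by
        rw [expectedLoss_prepend_vertex hβ_abs]
        simp only [stageCost, hτ]
    _ ≤ x k := hσ _ k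

lemma stepUpset_securedSet : stepUpset β r (securedSet β r) = securedSet β r :=
  have h := securedSet_subset_stepUpset hβ hr
  (subset_securedSet hβ hr (stepUpset_mono h)).antisymm h

lemma securedSet_nonempty [Nonempty (Fin m)] : (securedSet β r).Nonempty :=
  ⟨1, subset_securedSet hβ hr (U := {1}) (Set.singleton_subset_iff.mpr
    (one_mem_stepUpset hβ hr (Set.singleton_subset_iff.mpr ⟨zero_le_one, le_rfl⟩)
      (Set.singleton_nonempty 1))) rfl⟩

lemma isClosed_securedSet : IsClosed (securedSet β r) := by
  have h_compact : IsCompact (closure (securedSet β r)) :=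
    isCompact_Icc.of_isClosed_subset isClosed_closure
      (closure_minimal securedSet_subset_Icc isClosed_Icc)
  refine closure_subset_iff_isClosed.mp (subset_securedSet hβ hr ?_)
  exact closure_minimal ((securedSet_subset_stepUpset hβ hr).trans (stepUpset_mono subset_closure))
    (isClosed_stepUpset h_compact)

lemma convex_securedSet : Convex ℝ (securedSet β r) := by
  have h : convexHull ℝ (securedSet β r) ⊆ securedSet β r :=
    subset_securedSet hβ hr (convexHull_min
      ((securedSet_subset_stepUpset hβ hr).trans (stepUpset_mono (subset_convexHull ℝ _)))
      (convex_stepUpset (convex_convexHull ℝ _)))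
  exact convexHull_eq_self.mp (h.antisymm (subset_convexHull ℝ _))

lemma eq_securedSet_of_stepUpset_eq [Nonempty (Fin m)] (hU : stepUpset β r U = U)
    (hU_ne : U.Nonempty) (hU_closed : IsClosed U) : U = securedSet β r :=
  (subset_securedSet hβ hr hU.ge).antisymm (subset_of_subset_stepUpset_of_stepUpset_subset hβ hr
    (securedSet_subset_stepUpset hβ hr) hU.le (hU.ge.trans stepUpset_subset_Icc) hU_ne hU_closed)

end SecuredSet

section FixedPoint

variable {m n K : ℕ} {β : ℝ} {r : Fin m → Fin n → Fin K → ℝ} {V : Set (Fin K → ℝ)}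
  [Nonempty (Fin n)] (hβ : β ∈ Set.Ico (0 : ℝ) 1) (hr : ∀ a b k, r a b k ∈ Set.Icc 0 (1 - β))

include hβ hr

lemma upset_optimalFrontier : upset (optimalFrontier β r) = securedSet β r :=
  upset_paretoFrontier (guarantees_subset_Icc hβ hr) (isClosed_securedSet hβ hr)

lemma optimalFrontier_mem_frontierSpace [Nonempty (Fin m)] :
    optimalFrontier β r ∈ frontierSpace K := by
  have h_upset := upset_optimalFrontier hβ hr
  refine ⟨?_, optimalFrontier_subset_Icc hβ hr, fun _ hu _ hv huv =>
    isAntichain_paretoFrontier.eq hu hv huv, ?_, ?_⟩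
  · rw [← upset_nonempty_iff (optimalFrontier_subset_Icc hβ hr), h_upset]
    exact securedSet_nonempty hβ hr
  · exact h_upset ▸ isClosed_securedSet hβ hr
  · exact h_upset ▸ convex_securedSet hβ hr

lemma dpOperator_eq_paretoFrontier_stepUpset (hV : V ⊆ Set.Icc 0 1) :
    dpOperator β r V = paretoFrontier (stepUpset β r (upset V)) := by
  rw [stepUpset_upset hβ.1 hV]
  exact (paretoFrontier_upset (preOperator_subset_Icc hβ hr hV)).symm

lemma upset_dpOperator (hV : V ⊆ Set.Icc 0 1) (hc : IsClosed (upset V)) :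
    upset (dpOperator β r V) = stepUpset β r (upset V) := by
  have h_closed := isClosed_stepUpset (β := β) (r := r) (isCompact_upset hc)
  rw [stepUpset_upset hβ.1 hV] at h_closed ⊢
  exact upset_paretoFrontier (preOperator_subset_Icc hβ hr hV) h_closed

lemma dpOperator_optimalFrontier : dpOperator β r (optimalFrontier β r) = optimalFrontier β r := by
  rw [dpOperator_eq_paretoFrontier_stepUpset hβ hr (optimalFrontier_subset_Icc hβ hr),
    upset_optimalFrontier hβ hr, stepUpset_securedSet hβ hr, paretoFrontier_securedSet hβ hr]

lemma eq_optimalFrontier_of_dpOperator_eq [Nonempty (Fin m)] (hV_ne : V.Nonempty)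
    (hV : V ⊆ Set.Icc 0 1) (hc : IsClosed (upset V)) (h_fix : dpOperator β r V = V) :
    V = optimalFrontier β r := by
  have h_step : stepUpset β r (upset V) = upset V := by
    rw [← upset_dpOperator hβ hr hV hc, h_fix]
  have h_upset : upset V = securedSet β r :=
    eq_securedSet_of_stepUpset_eq hβ hr h_step ((upset_nonempty_iff hV).mpr hV_ne) hc
  calc V = paretoFrontier (upset V) := by
        rw [← h_step, ← dpOperator_eq_paretoFrontier_stepUpset hβ hr hV, h_fix]
    _ = optimalFrontier β r := by rw [h_upset, paretoFrontier_securedSet hβ hr]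

end FixedPoint

end VectorGame

theorem theorem2_general {m n K : ℕ} (hm : 0 < m) (hn : 0 < n) (β : ℝ)
    (hβ : β ∈ Set.Ico (0 : ℝ) 1) (r : Fin m → Fin n → Fin K → ℝ)
    (hr : ∀ a b k, r a b k ∈ Set.Icc (0 : ℝ) (1 - β)) :
    (VectorGame.optimalFrontier β r ∈ VectorGame.frontierSpace K ∧
      VectorGame.dpOperator β r (VectorGame.optimalFrontier β r) =
        VectorGame.optimalFrontier β r) ∧
    ∀ V : Set (Fin K → ℝ), V.Nonempty → V ⊆ Set.Icc 0 1 → IsClosed (VectorGame.upset V) →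
      VectorGame.dpOperator β r V = V → V = VectorGame.optimalFrontier β r := by
  have : Nonempty (Fin m) := Fin.pos_iff_nonempty.mp hm
  have : Nonempty (Fin n) := Fin.pos_iff_nonempty.mp hn
  exact ⟨⟨VectorGame.optimalFrontier_mem_frontierSpace hβ hr,
    VectorGame.dpOperator_optimalFrontier hβ hr⟩,
    fun _ => VectorGame.eq_optimalFrontier_of_dpOperator_eq hβ hr⟩

theorem theorem2 {m n K : ℕ} (hm : 0 < m) (hn : 0 < n) (β : ℝ) (hβ : β ∈ Set.Ico (0 : ℝ) 1)
    (r : Fin m → Fin n → Fin K → ℝ) (hr : ∀ a b k, r a b k ∈ Set.Icc (0 : ℝ) (1 - β)) :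
    (VectorGame.optimalFrontier β r ∈ VectorGame.frontierSpace K ∧
      VectorGame.dpOperator β r (VectorGame.optimalFrontier β r) =
        VectorGame.optimalFrontier β r) ∧
    ∀ V ∈ VectorGame.frontierSpace K,
      VectorGame.dpOperator β r V = V → V = VectorGame.optimalFrontier β r := by
  have h := theorem2_general hm hn β hβ r hr
  exact ⟨h.1, fun V hV => h.2 V hV.1 hV.2.1 hV.2.2.2.1⟩
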